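/- Let $n\in\mathbb N$ and let $E$, $F$ be (real) Banach lattices with $F$ Dedekind complete. An $n$-homogeneous polynomial $P\colon E\to F$ is called positive if its associated symmetric $n$-linear map $T_P\colon E^n\to F$ satisfies $T_P(x_1,\dots,x_n)\ge 0$ whenever $x_1,\dots,x_n\ge 0$; we write $P\le Q$ if $Q-P$ is positive. Let $\mathcal P^r({}^nE;F)$ be the vector space of regular $n$-homogeneous polynomials, i.e. differences of two positive ones; with the order above it is a Riesz space, since $F$ is Dedekind complete, and $|P|$ denotes the absolute value of $P$ in it. The regular norm of $P\in\mathcal P^r({}^nE;F)$ is $\|P\|_r=\|\,|P|\,\|$, where $\|Q\|=\sup\{\|Q(x)\| : \|x\|\le 1\}$. Let $\mathcal P({}^nE;F)$ be the space of continuous $n$-homogeneous polynomials from $E$ to $F$ with the norm $\|\cdot\|$. Let $\mathcal A$ be a closed linear subspace of $\mathcal P({}^nE;F)$ such that $(E,F)$ has the $\mathcal A$-domination property: if $P,Q\colon E\to F$ are $n$-homogeneous polynomials with $0\le P\le Q$ and $Q\in\mathcal A$, then $P\in\mathcal A$. Let $\mathcal A^+$ be the set of positive elements of $\mathcal A$ and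 $\mathcal A^r=\operatorname{span}\mathcal A^+\subseteq\mathcal P^r({}^nE;F)$. Then $$\|P\|_{\mathcal A,r}:=\inf\{\|Q\| : Q\in\mathcal A^+,\ Q\ge |P|\}$$ defines a complete lattice norm on $\mathcal A^r$, that is, $(\mathcal A^r,\|\cdot\|_{\mathcal A,r})$ is a Banach lattice. Moreover, $\|P\|_{\mathcal A,r}=\|P\|_r$ for every $P\in\mathcal A^r$, and $\mathcal A^r$ is an ideal in $\mathcal P^r({}^nE;F)$. -/

import Mathlib

open Set Filter Topology

set_option linter.unusedSectionVars false

noncomputable section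

/-! ### Homogeneous polynomials -/

/-- `T` is a symmetric `n`-linear map whose restriction to the diagonal is `P`, that is,
`P x = T (x, …, x)`. -/
structure IsAssociatedTo {n : ℕ} {E F : Type*} [AddCommGroup E] [Module ℝ E]
    [AddCommGroup F] [Module ℝ F]
    (T : MultilinearMap ℝ (fun _ : Fin n => E) F) (P : E → F) : Prop where
  symm : ∀ (σ : Equiv.Perm (Fin n)) (x : Fin n → E), T (fun i => x (σ i)) = T x
  diag : ∀ x : E, P x = T (fun _ => x)

/-- The vector space of all (not necessarily continuous) `n`-homogeneous polynomials `E → F`. -/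
def homPolySubmodule (n : ℕ) (E F : Type*) [AddCommGroup E] [Module ℝ E]
    [AddCommGroup F] [Module ℝ F] : Submodule ℝ (E → F) where
  carrier := {P | ∃ T : MultilinearMap ℝ (fun _ : Fin n => E) F, IsAssociatedTo T P}
  add_mem' := by
    rintro P Q ⟨S, hS⟩ ⟨T, hT⟩
    exact ⟨S + T, fun σ x => by simp [hS.symm σ x, hT.symm σ x],
      fun x => by simp [hS.diag, hT.diag]⟩
  zero_mem' := ⟨0, fun σ x => by simp, fun x => by simp⟩
  smul_mem' := by
    rintro c P ⟨S, hS⟩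
    exact ⟨c • S, fun σ x => by simp [hS.symm σ x], fun x => by simp [hS.diag]⟩

/-- The type of all (not necessarily continuous) `n`-homogeneous polynomials `E → F`. It carries
the pointwise vector space structure, but neither the pointwise order nor the topology of
pointwise convergence. -/
def HomPoly (n : ℕ) (E F : Type*) [AddCommGroup E] [Module ℝ E]
    [AddCommGroup F] [Module ℝ F] : Type _ :=
  ↥(homPolySubmodule n E F)

namespace HomPoly

section Algebra

variable {n : ℕ} {E F : Type*} [AddCommGroup E] [Module ℝ E] [AddCommGroup F] [Module ℝ F]

instance : AddCommGroup (HomPoly n E F) :=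
  inferInstanceAs (AddCommGroup ↥(homPolySubmodule n E F))

instance : Module ℝ (HomPoly n E F) :=
  inferInstanceAs (Module ℝ ↥(homPolySubmodule n E F))

instance : FunLike (HomPoly n E F) E F where
  coe P := P.1
  coe_injective := Subtype.val_injective

@[ext] theorem ext {P Q : HomPoly n E F} (h : ∀ x, P x = Q x) : P = Q := DFunLike.ext P Q h

@[simp] theorem zero_apply (x : E) : (0 : HomPoly n E F) x = 0 := rfl

@[simp] theorem add_apply (P Q : HomPoly n E F) (x : E) : (P + Q) x = P x + Q x := rfl

@[simp] theorem neg_apply (P : HomPoly n E F) (x : E) : (-P) x = -P x := rfl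

@[simp] theorem sub_apply (P Q : HomPoly n E F) (x : E) : (P - Q) x = P x - Q x := rfl

@[simp] theorem smul_apply (c : ℝ) (P : HomPoly n E F) (x : E) : (c • P) x = c • P x := rfl

theorem exists_associated (P : HomPoly n E F) :
    ∃ T : MultilinearMap ℝ (fun _ : Fin n => E) F, IsAssociatedTo T P := P.2

theorem map_smul_pow (P : HomPoly n E F) (c : ℝ) (x : E) : P (c • x) = c ^ n • P x := by
  obtain ⟨T, hT⟩ := P.exists_associated
  rw [hT.diag, hT.diag, T.map_smul_univ (fun _ => c) (fun _ => x)]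
  simp

end Algebra

end HomPoly

/-- Polarization: a symmetric multilinear map that vanishes on the diagonal is zero. -/
theorem IsAssociatedTo.eq_zero {n : ℕ} {E F : Type*} [AddCommGroup E] [Module ℝ E]
    [AddCommGroup F] [Module ℝ F] {T : MultilinearMap ℝ (fun _ : Fin n => E) F}
    (h : IsAssociatedTo T (0 : E → F)) : T = 0 := by
  classical
  ext x
  have h1 : ∀ s : Finset (Fin n),
      (∑ r : Fin n → Fin n, if (∀ i, r i ∈ s) then T (fun i => x (r i)) else 0) = 0 := by
    intro s
    have h2 := h.diag (∑ j ∈ s, x j)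
    have h3 := T.map_sum_finset (fun _ j => x j) (fun _ : Fin n => s)
    rw [← Finset.sum_filter]
    rw [Pi.zero_apply, h3] at h2
    rw [h2]
    refine Finset.sum_congr ?_ fun _ _ => rfl
    ext r
    simp [Fintype.mem_piFinset]
  have h4 : (∑ s : Finset (Fin n), ((-1 : ℤ) ^ s.card) •
      ∑ r : Fin n → Fin n, if (∀ i, r i ∈ s) then T (fun i => x (r i)) else 0) = 0 := by
    simp [h1]
  simp only [Finset.smul_sum] at h4
  rw [Finset.sum_comm] at h4
  have h5 : ∀ r : Fin n → Fin n,
      (∑ s : Finset (Fin n), ((-1 : ℤ) ^ s.card) •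
        (if (∀ i, r i ∈ s) then T (fun i => x (r i)) else 0)) =
      if Function.Bijective r then ((-1 : ℤ) ^ n) • T x else 0 := by
    intro r
    split_ifs with hr
    · rw [Finset.sum_eq_single Finset.univ]
      · have : T (fun i => x (r i)) = T x := h.symm (Equiv.ofBijective r hr) x
        simp only [Finset.mem_univ, implies_true, if_true, Finset.card_univ, Fintype.card_fin]
        rw [this]
      · intro s _ hs
        rw [if_neg, smul_zero]
        intro hrs
        exact hs (Finset.eq_univ_iff_forall.2 fun j => by
          obtain ⟨i, rfl⟩ := hr.2 j
          exact hrs i)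
      · simp
    · have hsurj : ¬ Function.Surjective r := fun hs => hr (Finite.surjective_iff_bijective.1 hs)
      simp only [Function.Surjective, not_forall] at hsurj
      obtain ⟨j, hj⟩ := hsurj
      push Not at hj
      refine Finset.sum_involution
        (fun s _ => if j ∈ s then s.erase j else insert j s) ?_ ?_ ?_ ?_
      · intro s _
        have hmem : ∀ t : Finset (Fin n), (∀ i, i ≠ j → (i ∈ t ↔ i ∈ s)) →
            ((∀ i, r i ∈ t) ↔ ∀ i, r i ∈ s) := fun t ht =>
          forall_congr' fun i => ht _ (hj i)
        by_cases hjs : j ∈ s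
        · simp only [hjs, if_true]
          rw [if_congr (hmem (s.erase j) fun i hi => by simp [hi]) rfl rfl]
          have hc : s.card = (s.erase j).card + 1 := (Finset.card_erase_add_one hjs).symm
          rw [hc, pow_succ, ← add_smul]
          simp
        · simp only [hjs, if_false]
          rw [if_congr (hmem (insert j s) fun i hi => by simp [hi]) rfl rfl,
            Finset.card_insert_of_notMem hjs, pow_succ, ← add_smul]
          simp
      · intro s _ _
        by_cases hjs : j ∈ s
        · simp only [hjs, if_true]
          intro he
          rw [← he] at hjs
          simp at hjs
        · simp only [hjs, if_false]
          intro he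
          rw [← he] at hjs
          simp at hjs
      · intro s _
        exact Finset.mem_univ _
      · intro s _
        by_cases hjs : j ∈ s
        · simp [hjs]
        · simp [hjs]
  simp only [h5] at h4
  rw [← Finset.sum_filter, Finset.sum_const] at h4
  have hcard : (Finset.univ.filter fun r : Fin n → Fin n => Function.Bijective r).card ≠ 0 := by
    rw [Finset.card_ne_zero]
    exact ⟨id, Finset.mem_filter.2 ⟨Finset.mem_univ _, Function.bijective_id⟩⟩
  rw [← Nat.cast_smul_eq_nsmul ℝ, smul_eq_zero, Nat.cast_eq_zero] at h4
  rcases h4 with h4 | h4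
  · exact absurd h4 hcard
  · rcases neg_one_pow_eq_or ℤ n with hn | hn <;> simpa [hn] using h4

/-- The symmetric multilinear map associated to a homogeneous polynomial is unique. -/
theorem IsAssociatedTo.unique {n : ℕ} {E F : Type*} [AddCommGroup E] [Module ℝ E]
    [AddCommGroup F] [Module ℝ F] {S T : MultilinearMap ℝ (fun _ : Fin n => E) F} {P : E → F}
    (hS : IsAssociatedTo S P) (hT : IsAssociatedTo T P) : S = T := by
  have h : IsAssociatedTo (S - T) (0 : E → F) :=
    ⟨fun σ x => by simp [hS.symm σ x, hT.symm σ x],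
      fun x => by simp [← hS.diag, ← hT.diag]⟩
  exact sub_eq_zero.1 h.eq_zero

/-! ### The order on homogeneous polynomials -/

namespace HomPoly

section Order

variable {n : ℕ} {E F : Type*} [AddCommGroup E] [Module ℝ E] [Lattice E] [IsOrderedAddMonoid E]
  [AddCommGroup F] [Module ℝ F] [PartialOrder F] [IsOrderedAddMonoid F]

/-- `P` is positive if its associated symmetric multilinear map (which exists and is unique) takes
nonnegative values on tuples of nonnegative vectors. -/
def IsPositive (P : HomPoly n E F) : Prop :=
  ∃ T : MultilinearMap ℝ (fun _ : Fin n => E) F,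
    IsAssociatedTo T P ∧ ∀ x : Fin n → E, (∀ i, 0 ≤ x i) → 0 ≤ T x

theorem IsPositive.add {P Q : HomPoly n E F} (hP : P.IsPositive) (hQ : Q.IsPositive) :
    (P + Q).IsPositive := by
  obtain ⟨S, hS, hS0⟩ := hP
  obtain ⟨T, hT, hT0⟩ := hQ
  exact ⟨S + T, ⟨fun σ x => by simp [hS.symm σ x, hT.symm σ x],
    fun x => by simp [hS.diag, hT.diag]⟩, fun x hx => add_nonneg (hS0 x hx) (hT0 x hx)⟩

theorem isPositive_zero : (0 : HomPoly n E F).IsPositive :=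
  ⟨0, ⟨fun σ x => by simp, fun x => by simp⟩, fun x _ => by simp⟩

theorem IsPositive.eq_zero {P : HomPoly n E F} (h : P.IsPositive) (h' : (-P).IsPositive) :
    P = 0 := by
  classical
  obtain ⟨S, hS, hS0⟩ := h
  obtain ⟨T, hT, hT0⟩ := h'
  have hST : S + T = 0 := IsAssociatedTo.eq_zero
    ⟨fun σ x => by simp [hS.symm σ x, hT.symm σ x], fun x => by simp [← hS.diag, ← hT.diag]⟩
  have h0 : ∀ x : Fin n → E, (∀ i, 0 ≤ x i) → S x = 0 := by
    intro x hx
    have h1 : S x + T x = 0 := by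
      rw [← _root_.add_apply, hST, _root_.zero_apply]
    refine le_antisymm ?_ (hS0 x hx)
    rw [eq_neg_of_add_eq_zero_left h1]
    exact neg_nonpos.2 (hT0 x hx)
  have hS' : S = 0 := by
    ext x
    have hx : x = (fun i => (x i)⁺) + fun i => -(x i)⁻ := by
      funext i
      rw [Pi.add_apply, ← sub_eq_add_neg, posPart_sub_negPart]
    rw [hx, S.map_add_univ, _root_.zero_apply]
    refine Finset.sum_eq_zero fun s _ => ?_
    have hs : s.piecewise (fun i => (x i)⁺) (fun i => -(x i)⁻) =
        fun i => (if i ∈ s then (1 : ℝ) else -1) • (if i ∈ s then (x i)⁺ else (x i)⁻) := by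
      funext i
      by_cases hi : i ∈ s <;> simp [hi]
    rw [hs, S.map_smul_univ, h0, smul_zero]
    intro i
    split_ifs
    · exact posPart_nonneg _
    · exact negPart_nonneg _
  ext x
  rw [hS.diag, hS']
  rfl

/-- `P ≤ Q` means that `Q - P` is positive. -/
instance : PartialOrder (HomPoly n E F) where
  le P Q := (Q - P).IsPositive
  le_refl P := by
    change (P - P).IsPositive
    rw [sub_self]
    exact isPositive_zero
  le_trans P Q R h h' := by
    change (R - P).IsPositive
    rw [← sub_add_sub_cancel R Q P]
    exact IsPositive.add h' h
  le_antisymm P Q h h' := by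
    have h1 : (-(Q - P)).IsPositive := by
      rw [neg_sub]
      exact h'
    exact (sub_eq_zero.1 (IsPositive.eq_zero h h1)).symm

theorem le_iff {P Q : HomPoly n E F} : P ≤ Q ↔ (Q - P).IsPositive := Iff.rfl

theorem nonneg_iff {P : HomPoly n E F} : 0 ≤ P ↔ P.IsPositive := by
  rw [le_iff, sub_zero]

theorem isPositive_smul [IsOrderedModule ℝ F] {c : ℝ} (hc : 0 ≤ c) {P : HomPoly n E F}
    (hP : P.IsPositive) : (c • P).IsPositive := by
  obtain ⟨S, hS, hS0⟩ := hP
  exact ⟨c • S, ⟨fun σ x => by simp [hS.symm σ x], fun x => by simp [hS.diag]⟩,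
    fun x hx => smul_nonneg hc (hS0 x hx)⟩

end Order

end HomPoly

section Regular

variable (n : ℕ) (E F : Type*) [AddCommGroup E] [Module ℝ E] [Lattice E] [IsOrderedAddMonoid E]
  [AddCommGroup F] [Module ℝ F] [PartialOrder F] [IsOrderedAddMonoid F] [IsOrderedModule ℝ F]

/-- The space of regular `n`-homogeneous polynomials: differences of two positive ones. -/
def regularHomPoly : Submodule ℝ (HomPoly n E F) where
  carrier := {P | ∃ Q R : HomPoly n E F, 0 ≤ Q ∧ 0 ≤ R ∧ P = Q - R}
  add_mem' := by
    rintro P P' ⟨Q, R, hQ, hR, rfl⟩ ⟨Q', R', hQ', hR', rfl⟩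
    rw [HomPoly.nonneg_iff] at *
    refine ⟨Q + Q', R + R', ?_, ?_, by abel⟩ <;> rw [HomPoly.nonneg_iff]
    exacts [hQ.add hQ', hR.add hR']
  zero_mem' := ⟨0, 0, le_rfl, le_rfl, by simp⟩
  smul_mem' := by
    rintro c P ⟨Q, R, hQ, hR, rfl⟩
    rw [HomPoly.nonneg_iff] at hQ hR
    rcases le_total 0 c with hc | hc
    · refine ⟨c • Q, c • R, ?_, ?_, smul_sub c Q R⟩ <;> rw [HomPoly.nonneg_iff]
      exacts [HomPoly.isPositive_smul hc hQ, HomPoly.isPositive_smul hc hR]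
    · have hc' : 0 ≤ -c := neg_nonneg.2 hc
      refine ⟨(-c) • R, (-c) • Q, ?_, ?_, by rw [smul_sub]; simp [neg_smul]; abel⟩ <;>
        rw [HomPoly.nonneg_iff]
      exacts [HomPoly.isPositive_smul hc' hR, HomPoly.isPositive_smul hc' hQ]

/-- The regular `n`-homogeneous polynomials as a vector space, ordered by `P ≤ Q` if and only if
`Q - P` is positive. -/
abbrev RegHomPoly : Type _ := ↥(regularHomPoly n E F)

end Regular

/-! ### Continuous homogeneous polynomials and the sup norm -/

/-- The usual norm of a homogeneous polynomial, `‖P‖ = sup {‖P x‖ : ‖x‖ ≤ 1}`. -/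
def HomPoly.supNorm {n : ℕ} {E F : Type*} [NormedAddCommGroup E] [NormedSpace ℝ E]
    [NormedAddCommGroup F] [NormedSpace ℝ F] (P : HomPoly n E F) : ℝ :=
  sSup {r : ℝ | ∃ x : E, ‖x‖ ≤ 1 ∧ r = ‖P x‖}

section Continuous

variable (n : ℕ) (E F : Type*) [NormedAddCommGroup E] [NormedSpace ℝ E]
  [NormedAddCommGroup F] [NormedSpace ℝ F]

/-- The space of continuous `n`-homogeneous polynomials. -/
def continuousHomPoly : Submodule ℝ (HomPoly n E F) where
  carrier := {P | Continuous P}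
  add_mem' hP hQ := Continuous.add hP hQ
  zero_mem' := continuous_const (y := (0 : F))
  smul_mem' c _ hP := Continuous.const_smul hP c

/-- The continuous `n`-homogeneous polynomials, as a normed space with the usual sup norm. -/
abbrev ContHomPoly : Type _ := ↥(continuousHomPoly n E F)

variable {n E F}

theorem ContHomPoly.bddAbove (P : ContHomPoly n E F) :
    BddAbove {r : ℝ | ∃ x : E, ‖x‖ ≤ 1 ∧ r = ‖P.1 x‖} := by
  have hP : Continuous (P.1 : E → F) := P.2
  obtain ⟨δ, hδ, h⟩ := Metric.continuous_iff.1 hP 0 1 one_pos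
  refine ⟨((δ / 2)⁻¹) ^ n * (1 + ‖P.1 0‖), ?_⟩
  rintro r ⟨x, hx, rfl⟩
  have hδ2 : 0 < δ / 2 := half_pos hδ
  have h1 : dist ((δ / 2) • x) 0 < δ := by
    rw [dist_zero_right, norm_smul, Real.norm_of_nonneg hδ2.le]
    nlinarith
  have h2 := h _ h1
  have h3 : ‖P.1 ((δ / 2) • x)‖ ≤ 1 + ‖P.1 0‖ := by
    have := norm_le_norm_add_norm_sub' (P.1 ((δ / 2) • x)) (P.1 0)
    rw [dist_eq_norm] at h2
    linarith
  have h4 : P.1 x = ((δ / 2)⁻¹) ^ n • P.1 ((δ / 2) • x) := by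
    rw [← HomPoly.map_smul_pow, inv_smul_smul₀ hδ2.ne']
  rw [h4, norm_smul, Real.norm_of_nonneg (by positivity)]
  gcongr

theorem ContHomPoly.nonempty (P : HomPoly n E F) :
    {r : ℝ | ∃ x : E, ‖x‖ ≤ 1 ∧ r = ‖P x‖}.Nonempty := ⟨_, 0, by simp, rfl⟩

theorem HomPoly.supNorm_nonneg (P : HomPoly n E F) : 0 ≤ P.supNorm :=
  Real.sSup_nonneg (by rintro r ⟨x, -, rfl⟩; exact norm_nonneg _)

theorem ContHomPoly.le_supNorm (P : ContHomPoly n E F) {x : E} (hx : ‖x‖ ≤ 1) :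
    ‖P.1 x‖ ≤ P.1.supNorm := le_csSup P.bddAbove ⟨x, hx, rfl⟩

theorem ContHomPoly.supNorm_smul_le (c : ℝ) (P : ContHomPoly n E F) :
    (c • P).1.supNorm ≤ ‖c‖ * P.1.supNorm := by
  refine csSup_le (ContHomPoly.nonempty _) ?_
  rintro r ⟨x, hx, rfl⟩
  have : (c • P).1 x = c • P.1 x := rfl
  rw [this, norm_smul]
  exact mul_le_mul_of_nonneg_left (P.le_supNorm hx) (norm_nonneg c)

instance : Norm (ContHomPoly n E F) := ⟨fun P => P.1.supNorm⟩

theorem ContHomPoly.norm_def (P : ContHomPoly n E F) : ‖P‖ = P.1.supNorm := rfl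

theorem ContHomPoly.normedSpaceCore : NormedSpace.Core ℝ (ContHomPoly n E F) where
  norm_nonneg P := P.1.supNorm_nonneg
  norm_smul c P := by
    refine le_antisymm (ContHomPoly.supNorm_smul_le c P) ?_
    rcases eq_or_ne c 0 with rfl | hc
    · rw [norm_zero, zero_mul]
      exact HomPoly.supNorm_nonneg _
    · have h := ContHomPoly.supNorm_smul_le c⁻¹ (c • P)
      rw [inv_smul_smul₀ hc, norm_inv] at h
      have hc' : 0 < ‖c‖ := norm_pos_iff.2 hc
      calc ‖c‖ * P.1.supNorm ≤ ‖c‖ * (‖c‖⁻¹ * (c • P).1.supNorm) := by gcongr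
        _ = (c • P).1.supNorm := by rw [mul_inv_cancel_left₀ hc'.ne']
  norm_triangle P Q := by
    refine csSup_le (ContHomPoly.nonempty _) ?_
    rintro r ⟨x, hx, rfl⟩
    exact (norm_add_le (P.1 x) (Q.1 x)).trans
      (add_le_add (P.le_supNorm hx) (Q.le_supNorm hx))
  norm_eq_zero_iff P := by
    constructor
    · intro h
      ext x
      rcases eq_or_ne x 0 with rfl | hx
      · have := P.le_supNorm (x := 0) (by simp)
        rw [← ContHomPoly.norm_def, h] at this
        exact norm_le_zero_iff.1 this
      · have hx' : ‖x‖ ≠ 0 := norm_ne_zero_iff.2 hx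
        have h1 := P.le_supNorm (x := ‖x‖⁻¹ • x) (by
          rw [norm_smul, norm_inv, norm_norm, inv_mul_cancel₀ hx'])
        rw [← ContHomPoly.norm_def, h, HomPoly.map_smul_pow] at h1
        have h2 := norm_le_zero_iff.1 h1
        rw [smul_eq_zero] at h2
        rcases h2 with h2 | h2
        · exact absurd h2 (pow_ne_zero n (inv_ne_zero hx'))
        · exact h2
    · rintro rfl
      have h0 : {r : ℝ | ∃ x : E, ‖x‖ ≤ 1 ∧ r = ‖(0 : ContHomPoly n E F).1 x‖} = {0} := by
        ext r
        constructor
        · rintro ⟨x, -, rfl⟩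
          exact norm_zero
        · rintro rfl
          exact ⟨0, by simp, norm_zero.symm⟩
      change sSup _ = 0
      rw [h0, csSup_singleton]

instance : NormedAddCommGroup (ContHomPoly n E F) :=
  NormedAddCommGroup.ofCore ContHomPoly.normedSpaceCore

instance : NormedSpace ℝ (ContHomPoly n E F) :=
  NormedSpace.ofCore ContHomPoly.normedSpaceCore

end Continuous

/-! ### Riesz spaces, ideals and Banach lattices as properties of a partially ordered space -/

/-- Dedekind completeness: every nonempty subset that is bounded above has a supremum. -/
def IsDedekindComplete (V : Type*) [PartialOrder V] : Prop :=
  ∀ s : Set V, s.Nonempty → BddAbove s → ∃ a, IsLUB s a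

/-- A Riesz space (vector lattice): an ordered vector space in which any two elements have a
supremum (hence also an infimum). -/
structure IsRieszSpace (V : Type*) [AddCommGroup V] [Module ℝ V] [PartialOrder V] : Prop where
  isOrderedAddMonoid : IsOrderedAddMonoid V
  smul_nonneg : ∀ (c : ℝ) (x : V), 0 ≤ c → 0 ≤ x → 0 ≤ c • x
  exists_isLUB : ∀ x y : V, ∃ z, IsLUB {x, y} z

open Classical in
/-- The absolute value `|x| = x ∨ (-x)`: the least upper bound of `x` and `-x` whenever it exists,
as it always does in a Riesz space (and the irrelevant value `0` otherwise). -/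
def absValue {V : Type*} [AddCommGroup V] [PartialOrder V] (x : V) : V :=
  if h : ∃ z, IsLUB {x, -x} z then h.choose else 0

theorem isLUB_absValue {V : Type*} [AddCommGroup V] [PartialOrder V] {x : V}
    (h : ∃ z, IsLUB {x, -x} z) : IsLUB {x, -x} (absValue x) := by
  rw [absValue, dif_pos h]
  exact h.choose_spec

theorem absValue_eq_abs {V : Type*} [AddCommGroup V] [Lattice V] (x : V) : absValue x = |x| :=
  (isLUB_absValue ⟨_, isLUB_pair⟩).unique isLUB_pair

/-- An (order) ideal of a Riesz space: a linear subspace `I` that is solid, i.e. `|x| ≤ |y|` and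
`y ∈ I` imply `x ∈ I`. -/
def IsRieszIdeal {V : Type*} [AddCommGroup V] [Module ℝ V] [PartialOrder V]
    (I : Submodule ℝ V) : Prop :=
  ∀ x y : V, y ∈ I → absValue x ≤ absValue y → x ∈ I

/-- `V` with the norm `N` is a Banach lattice: `V` is a Riesz space and `N` is a complete
lattice norm on it. -/
structure IsBanachLattice (V : Type*) [AddCommGroup V] [Module ℝ V] [PartialOrder V]
    (N : V → ℝ) : Prop extends IsRieszSpace V where
  nonneg : ∀ x, 0 ≤ N x
  eq_zero_iff : ∀ x, N x = 0 ↔ x = 0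
  smul : ∀ (c : ℝ) (x : V), N (c • x) = |c| * N x
  add_le : ∀ x y, N (x + y) ≤ N x + N y
  solid : ∀ x y, absValue x ≤ absValue y → N x ≤ N y
  complete : ∀ u : ℕ → V,
    (∀ ε : ℝ, 0 < ε → ∃ k, ∀ i ≥ k, ∀ j ≥ k, N (u i - u j) < ε) →
      ∃ x, Tendsto (fun i => N (u i - x)) atTop (𝓝 0)

/-! ### The regular part of a space of polynomials -/

section RegularPart

variable {n : ℕ} {E F : Type*} [NormedAddCommGroup E] [NormedSpace ℝ E] [Lattice E]
  [IsOrderedAddMonoid E] [NormedAddCommGroup F] [NormedSpace ℝ F] [Lattice F]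
  [IsOrderedAddMonoid F] [IsOrderedModule ℝ F]

/-- The domination property of the pair `(E, F)` with respect to `A`: if `0 ≤ P ≤ Q` and `Q ∈ A`,
then `P ∈ A`. -/
def HasDominationProperty (A : Submodule ℝ (HomPoly n E F)) : Prop :=
  ∀ P Q : HomPoly n E F, 0 ≤ P → P ≤ Q → Q ∈ A → P ∈ A

/-- The set `A⁺` of all positive polynomials belonging to `A`. -/
def positiveElements (A : Submodule ℝ (HomPoly n E F)) : Set (RegHomPoly n E F) :=
  {Q | (Q : HomPoly n E F) ∈ A ∧ 0 ≤ Q}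

/-- The linear span `Aʳ` of `A⁺`, as a subspace of the space of regular polynomials. -/
def regularPart (A : Submodule ℝ (HomPoly n E F)) : Submodule ℝ (RegHomPoly n E F) :=
  Submodule.span ℝ (positiveElements A)

/-- The regular norm `‖P‖_r = ‖ |P| ‖`, where `|P|` is the absolute value of `P` in the space of
regular polynomials. -/
def regularNorm (P : RegHomPoly n E F) : ℝ :=
  HomPoly.supNorm (absValue P : RegHomPoly n E F).1

/-- `inf {‖Q‖ : Q ∈ A⁺, Q ≥ |P|}`, where `|P|` is the absolute value of `P` in the space of
regular polynomials. -/
def dominatedNorm (A : Submodule ℝ (HomPoly n E F)) (P : RegHomPoly n E F) : ℝ :=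
  sInf {r : ℝ | ∃ Q ∈ positiveElements A, absValue P ≤ Q ∧ r = HomPoly.supNorm Q.1}

end RegularPart

end

noncomputable section

/-! ### The Riesz–Kantorovich theorem for multilinear maps -/

section RieszKantorovich

/-! Order structure. By polarization (`IsAssociatedTo.unique`), the order on polynomials is the
order of their symmetric multilinear maps on the positive cone. There Riesz–Kantorovich applies
(`exists_isLUB_multilinear`): split the coordinates of `x` into positive summands, evaluate a member
of the family on each piece, add up, and take the supremum of these sums in the Dedekind complete
space `F`. Recording the splittings as binary trees, one coordinate at a time (`PartitionSum`), lets
induction replace grids of partitions. The supremum is additive in each variable by Riesz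
decomposition and extends off the cone by differences; for symmetric maps it is again symmetric.

The space `regularPart A`. Each of its elements `P` satisfies `±P ≤ C` for some `C` in `A⁺`.
Conversely `±P ≤ C` gives `0 ≤ P + C ≤ 2C`, so domination puts `P + C` in `A` and `P = (P + C) - C`
in the span. Hence the span is solid, is closed under suprema, and contains `|P|`, which lies in
`A⁺`. The sup norm is monotone because `±P ≤ Q` forces `|P x| ≤ Q |x|`; so `|P|` attains the
infimum, and the two norms agree.

Completeness. It suffices to sum a series `∑ uₖ` with `∑ ‖uₖ‖_r < ∞`. The series `∑ |uₖ|` converges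
in sup norm, with sum in the closed space `A`. It dominates `∑ uₖ`, which therefore converges
pointwise to a polynomial in `regularPart A`. The same argument applied to the tails bounds the
error in the regular norm (`HomPoly.exists_hasSum_of_dominated`). -/

/-- Riesz decomposition: two decompositions of a positive vector have a common refinement. -/
theorem exists_common_refinement {E : Type*} [AddCommGroup E] [Lattice E] [IsOrderedAddMonoid E]
    {u v u' v' : E} (hu : 0 ≤ u) (hv : 0 ≤ v) (hu' : 0 ≤ u') (hv' : 0 ≤ v')
    (h : u + v = u' + v') :
    ∃ p q r s : E, 0 ≤ p ∧ 0 ≤ q ∧ 0 ≤ r ∧ 0 ≤ s ∧ u = p + r ∧ v = q + s ∧ u' = p + q ∧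
      v' = r + s := by
  have hv'' : v' = u + v - u' := by rw [h]; abel
  -- Once `p = u ⊓ u'` is chosen, the rest is forced. Only `0 ≤ s` needs an argument: translating
  -- the infimum by `v - u'` shows `s = v' ⊓ v`.
  refine ⟨u ⊓ u', u' - u ⊓ u', u - u ⊓ u', v - (u' - u ⊓ u'), le_inf hu hu',
    sub_nonneg.2 inf_le_right, sub_nonneg.2 inf_le_left, ?_, by abel, by abel, by abel,
    by rw [hv'']; abel⟩
  have h1 : v - (u' - u ⊓ u') = (v - u') + u ⊓ u' := by abel
  have h2 : v - u' + u = v' := by rw [hv'']; abel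
  rw [h1, add_inf, h2, sub_add_cancel]
  exact le_inf hv' hv

/-- A function on the positive cone that is additive and positively homogeneous, extended to the
whole space by differences. -/
theorem posPart_negPart_extension {E F : Type*} [AddCommGroup E] [Module ℝ E] [Lattice E]
    [IsOrderedAddMonoid E] [IsOrderedModule ℝ E] [AddCommGroup F] [Module ℝ F] {φ : E → F}
    (hadd : ∀ u v, 0 ≤ u → 0 ≤ v → φ (u + v) = φ u + φ v)
    (hsmul : ∀ (c : ℝ) (u), 0 < c → 0 ≤ u → φ (c • u) = c • φ u) :
    (∀ u v, φ (u + v)⁺ - φ (u + v)⁻ = (φ u⁺ - φ u⁻) + (φ v⁺ - φ v⁻)) ∧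
      ∀ (c : ℝ) (u), φ (c • u)⁺ - φ (c • u)⁻ = c • (φ u⁺ - φ u⁻) := by
  -- Any representation of `u` as a difference of positive vectors gives the same value, so sums and
  -- multiples may be computed with a convenient one.
  have key : ∀ u a b : E, 0 ≤ a → 0 ≤ b → u = a - b → φ u⁺ - φ u⁻ = φ a - φ b := by
    intro u a b ha hb h
    have h1 : u⁺ + b = a + u⁻ := by
      have := posPart_sub_negPart u
      rw [h] at this ⊢
      rw [sub_eq_sub_iff_add_eq_add] at this
      exact this
    rw [sub_eq_sub_iff_add_eq_add, ← hadd _ _ (posPart_nonneg _) hb,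
      ← hadd _ _ ha (negPart_nonneg _), h1]
  have h0 : φ 0 = 0 := by simpa using hadd 0 0 le_rfl le_rfl
  refine ⟨fun u v => ?_, fun c u => ?_⟩
  · rw [key (u + v) (u⁺ + v⁺) (u⁻ + v⁻) (add_nonneg (posPart_nonneg _) (posPart_nonneg _))
      (add_nonneg (negPart_nonneg _) (negPart_nonneg _)), hadd _ _ (posPart_nonneg _)
      (posPart_nonneg _), hadd _ _ (negPart_nonneg _) (negPart_nonneg _)]
    · abel
    · nth_rewrite 1 [← posPart_sub_negPart u, ← posPart_sub_negPart v]
      abel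
  · rcases lt_trichotomy c 0 with hc | rfl | hc
    · have hc' : 0 < -c := neg_pos.2 hc
      rw [key (c • u) ((-c) • u⁻) ((-c) • u⁺) (smul_nonneg hc'.le (negPart_nonneg _))
        (smul_nonneg hc'.le (posPart_nonneg _)), hsmul _ _ hc' (negPart_nonneg _),
        hsmul _ _ hc' (posPart_nonneg _)]
      · module
      · nth_rewrite 1 [← posPart_sub_negPart u]
        module
    · simp [h0]
    · rw [key (c • u) (c • u⁺) (c • u⁻) (smul_nonneg hc.le (posPart_nonneg _))
        (smul_nonneg hc.le (negPart_nonneg _)), hsmul _ _ hc (negPart_nonneg _),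
        hsmul _ _ hc (posPart_nonneg _), smul_sub]
      nth_rewrite 1 [← posPart_sub_negPart u]
      rw [smul_sub]

variable {ι E F : Type*} [Fintype ι] [DecidableEq ι] [AddCommGroup E] [Module ℝ E] [Lattice E]
  [IsOrderedAddMonoid E] [IsOrderedModule ℝ E] [AddCommGroup F] [Module ℝ F]

open Function in
/-- A function that is additive and positively homogeneous in each variable on the positive cone
extends to a multilinear map. -/
theorem exists_multilinear_extension (g : (ι → E) → F)
    (hadd : ∀ x i u v, (∀ j, 0 ≤ x j) → 0 ≤ u → 0 ≤ v →
      g (update x i (u + v)) = g (update x i u) + g (update x i v))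
    (hsmul : ∀ x i (c : ℝ) u, (∀ j, 0 ≤ x j) → 0 < c → 0 ≤ u →
      g (update x i (c • u)) = c • g (update x i u)) :
    ∃ G : MultilinearMap ℝ (fun _ : ι => E) F, ∀ x, (∀ j, 0 ≤ x j) → G x = g x := by
  -- Expanding every `x j = (x j)⁺ - (x j)⁻` dictates the signed sum `G`; `s` is the set of slots
  -- that take the negative part. `φ x i` collects the sets avoiding `i`, with slot `i` left free.
  let pm : Finset ι → (ι → E) → ι → E := fun s x j => if j ∈ s then (x j)⁻ else (x j)⁺
  have hpm : ∀ s x j, 0 ≤ pm s x j := by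
    intro s x j
    simp only [pm]
    split_ifs
    exacts [negPart_nonneg _, posPart_nonneg _]
  let φ : (ι → E) → ι → E → F := fun x i w =>
    ∑ s ∈ (Finset.univ.erase i).powerset, (-1 : ℤ) ^ s.card • g (update (pm s x) i w)
  let G : (ι → E) → F := fun x => ∑ s : Finset ι, (-1 : ℤ) ^ s.card • g (pm s x)
  have hG : ∀ x i w, G (update x i w) = φ x i w⁺ - φ x i w⁻ := by
    intro x i w
    have hu : (Finset.univ : Finset (Finset ι)) =
        (insert i (Finset.univ.erase i)).powerset := by
      rw [Finset.insert_erase (Finset.mem_univ i), Finset.powerset_univ]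
    simp only [G, φ]
    rw [hu, Finset.sum_powerset_insert (Finset.notMem_erase i _), sub_eq_add_neg,
      ← Finset.sum_neg_distrib]
    congr 1
    · refine Finset.sum_congr rfl fun s hs => ?_
      have hi : i ∉ s := fun h => by simpa using Finset.mem_powerset.1 hs h
      congr 2
      ext j
      by_cases hj : j = i
      · subst hj; simp [pm, hi]
      · simp [pm, hj]
    · refine Finset.sum_congr rfl fun s hs => ?_
      have hi : i ∉ s := fun h => by simpa using Finset.mem_powerset.1 hs h
      rw [Finset.card_insert_of_notMem hi, pow_succ, mul_neg_one, neg_smul]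
      congr 3
      ext j
      by_cases hj : j = i
      · subst hj; simp [pm]
      · simp [pm, hj]
  have hφ := fun x i => posPart_negPart_extension (φ := φ x i)
    (fun u v hu hv => by
      simp only [φ]
      rw [← Finset.sum_add_distrib]
      exact Finset.sum_congr rfl fun s _ => by rw [hadd _ _ _ _ (hpm s x) hu hv, smul_add])
    (fun c u hc hu => by
      simp only [φ]
      rw [Finset.smul_sum]
      exact Finset.sum_congr rfl fun s _ => by
        rw [hsmul _ _ _ _ (hpm s x) hc hu, smul_comm])
  refine ⟨MultilinearMap.mk' G ?_ ?_, fun x hx => ?_⟩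
  · intro x i u v
    rw [hG, hG, hG, (hφ x i).1]
  · intro x i c u
    rw [hG, hG, (hφ x i).2]
  · change G x = g x
    -- On the cone all negative parts vanish, so only the term `s = ∅` survives.
    have h0 : ∀ y i, (∀ j, 0 ≤ y j) → y i = 0 → g y = 0 := by
      intro y i hy hi
      have := hadd y i 0 0 hy le_rfl le_rfl
      rw [add_zero, ← hi, update_eq_self] at this
      simpa using this
    simp only [G]
    rw [Finset.sum_eq_single ∅]
    · have : pm ∅ x = x := by
        ext j
        simp [pm, posPart_of_nonneg (hx j)]
      simp [this]
    · intro s _ hs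
      obtain ⟨i, hi⟩ := Finset.nonempty_iff_ne_empty.2 hs
      rw [h0 _ i (hpm s x), smul_zero]
      simp [pm, hi, negPart_of_nonneg (hx i)]
    · simp

variable [PartialOrder F] [IsOrderedAddMonoid F] [IsOrderedModule ℝ F]

open Function in
/-- The finite sums `∑ Tₖ(xₖ)` with `Tₖ ∈ S`, where the family `xₖ` arises from `x` by repeatedly
splitting a coordinate into a sum of two positive vectors. -/
inductive PartitionSum (S : Set (MultilinearMap ℝ (fun _ : ι => E) F)) : (ι → E) → F → Prop
  | single {T x} (hT : T ∈ S) : PartitionSum S x (T x)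
  | split {x i u v a b} (hu : 0 ≤ u) (hv : 0 ≤ v) (h : x i = u + v)
      (ha : PartitionSum S (update x i u) a) (hb : PartitionSum S (update x i v) b) :
      PartitionSum S x (a + b)

open Function in
theorem PartitionSum.le {S : Set (MultilinearMap ℝ (fun _ : ι => E) F)}
    {B : MultilinearMap ℝ (fun _ : ι => E) F}
    (hB : ∀ T ∈ S, ∀ x, (∀ i, 0 ≤ x i) → T x ≤ B x) {x : ι → E} {a : F}
    (h : PartitionSum S x a) (hx : ∀ i, 0 ≤ x i) : a ≤ B x := by
  induction h with
  | single hT => exact hB _ hT _ hx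
  | @split x i u v a b hu hv h _ _ iha ihb =>
    have h1 := B.map_update_add x i u v
    rw [← h, update_eq_self] at h1
    rw [h1]
    refine add_le_add (iha fun j => ?_) (ihb fun j => ?_) <;>
    · rcases eq_or_ne j i with rfl | hj
      · simpa
      · simpa [hj] using hx j

-- Scaling coordinate `i` everywhere in a splitting tree scales every leaf. A split in coordinate
-- `i` has its two summands scaled; a split in another coordinate is unchanged.
open Function in
theorem PartitionSum.smul {S : Set (MultilinearMap ℝ (fun _ : ι => E) F)} {x : ι → E} {a : F}
    (h : PartitionSum S x a) (i : ι) {c : ℝ} (hc : 0 ≤ c) :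
    PartitionSum S (update x i (c • x i)) (c • a) := by
  induction h with
  | @single T x hT =>
    rw [show c • T x = T (update x i (c • x i)) by
      rw [T.map_update_smul, update_eq_self]]
    exact .single hT
  | @split x j u v a b hu hv h _ _ iha ihb =>
    rw [smul_add]
    rcases eq_or_ne j i with rfl | hj
    · simp only [update_self, update_idem] at iha ihb
      refine .split (i := j) (u := c • u) (v := c • v) (smul_nonneg hc hu) (smul_nonneg hc hv)
        (by simp [h]) ?_ ?_ <;> simpa
    · refine .split (i := j) (u := u) (v := v) hu hv (by simp [hj, h]) ?_ ?_
      · rw [update_comm hj.symm]; simpa [hj.symm] using iha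
      · rw [update_comm hj.symm]; simpa [hj.symm] using ihb

open Function in
/-- **Riesz–Kantorovich**: if `F` is Dedekind complete, so is the space of multilinear maps ordered
by positivity on the positive cone. -/
theorem exists_isLUB_multilinear (hF : IsDedekindComplete F)
    {S : Set (MultilinearMap ℝ (fun _ : ι => E) F)} (hS : S.Nonempty)
    {B : MultilinearMap ℝ (fun _ : ι => E) F}
    (hB : ∀ T ∈ S, ∀ x, (∀ i, 0 ≤ x i) → T x ≤ B x) :
    ∃ G : MultilinearMap ℝ (fun _ : ι => E) F,
      (∀ T ∈ S, ∀ x, (∀ i, 0 ≤ x i) → T x ≤ G x) ∧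
      ∀ C : MultilinearMap ℝ (fun _ : ι => E) F,
        (∀ T ∈ S, ∀ x, (∀ i, 0 ≤ x i) → T x ≤ C x) → ∀ x, (∀ i, 0 ≤ x i) → G x ≤ C x := by
  -- Off the cone the value is an irrelevant `0`; the extension only uses `g` on the cone.
  have hex : ∀ x : ι → E, ∃ a, (∀ i, 0 ≤ x i) → IsLUB {a | PartitionSum S x a} a := by
    intro x
    by_cases hx : ∀ i, 0 ≤ x i
    · obtain ⟨T, hT⟩ := hS
      obtain ⟨a, ha⟩ := hF {a | PartitionSum S x a} ⟨_, .single hT⟩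
        ⟨B x, fun a ha => PartitionSum.le hB ha hx⟩
      exact ⟨a, fun _ => ha⟩
    · exact ⟨0, fun h => absurd h hx⟩
  choose g hg using hex
  have hpos : ∀ {x : ι → E} {i : ι} {u : E}, (∀ j, 0 ≤ x j) → 0 ≤ u →
      ∀ j, 0 ≤ update x i u j := by
    intro x i u hx hu j
    rcases eq_or_ne j i with rfl | hj
    · simpa
    · simpa [hj] using hx j
  have hsup : ∀ x i u v, (∀ j, 0 ≤ x j) → 0 ≤ u → 0 ≤ v →
      g (update x i u) + g (update x i v) ≤ g (update x i (u + v)) := by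
    intro x i u v hx hu hv
    have h1 : ∀ a, PartitionSum S (update x i u) a → ∀ b, PartitionSum S (update x i v) b →
        a + b ≤ g (update x i (u + v)) := fun a ha b hb =>
      (hg _ (hpos hx (add_nonneg hu hv))).1
        (.split (i := i) hu hv (by simp) (by simpa using ha) (by simpa using hb))
    rw [← le_sub_iff_add_le]
    refine (hg _ (hpos hx hu)).2 fun a ha => ?_
    rw [le_sub_comm]
    refine (hg _ (hpos hx hv)).2 fun b hb => ?_
    rw [le_sub_iff_add_le']
    exact h1 a ha b hb
  -- Subadditivity, by induction on the splitting tree. A split in coordinate `i` itself is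
  -- reconciled with `u + v` by a common refinement; a split in another coordinate commutes with it.
  -- In both cases the pieces are regrouped by `hsup`.
  have hsub : ∀ x a, PartitionSum S x a → (∀ j, 0 ≤ x j) → ∀ i u v, 0 ≤ u → 0 ≤ v →
      x i = u + v → a ≤ g (update x i u) + g (update x i v) := by
    intro x a ha
    induction ha with
    | @single T x hT =>
      intro hx i u v hu hv h
      have h1 := T.map_update_add x i u v
      rw [← h, update_eq_self] at h1
      rw [h1]
      exact add_le_add ((hg _ (hpos hx hu)).1 (.single hT)) ((hg _ (hpos hx hv)).1 (.single hT))
    | @split x j u' v' a b hu' hv' h' _ _ iha ihb =>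
      intro hx i u v hu hv h
      rcases eq_or_ne i j with rfl | hij
      · obtain ⟨p, q, r, s, hp, hq, hr, hs, rfl, rfl, rfl, rfl⟩ :=
          exists_common_refinement hu hv hu' hv' (h.symm.trans h')
        have h1 := iha (hpos hx hu') i p q hp hq (by simp)
        have h2 := ihb (hpos hx hv') i r s hr hs (by simp)
        rw [update_idem, update_idem] at h1 h2
        calc a + b ≤ _ := add_le_add h1 h2
          _ = (g (update x i p) + g (update x i r)) + (g (update x i q) + g (update x i s)) := by
            abel
          _ ≤ _ := add_le_add (hsup x i p r hx hp hr) (hsup x i q s hx hq hs)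
      · have h1 := iha (hpos hx hu') i u v hu hv (by simpa [hij] using h)
        have h2 := ihb (hpos hx hv') i u v hu hv (by simpa [hij] using h)
        have h0 : ∀ s t, update (update x j s) i t = update (update x i t) j s :=
          fun s t => update_comm hij.symm s t x
        rw [h0, h0] at h1 h2
        have h3 := hsup (update x i u) j u' v' (hpos hx hu) hu' hv'
        have h4 := hsup (update x i v) j u' v' (hpos hx hv) hu' hv'
        have h5 : ∀ w, update (update x i w) j (u' + v') = update x i w := by
          intro w
          rw [← h', update_comm hij, update_eq_self]
        rw [h5] at h3 h4
        calc a + b ≤ _ := add_le_add h1 h2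
          _ = _ := add_add_add_comm _ _ _ _
          _ ≤ _ := add_le_add h3 h4
  -- Only this inequality is needed: applied with `c⁻¹` it gives the reverse one.
  have hsm : ∀ x i (c : ℝ), (∀ j, 0 ≤ x j) → 0 < c → c • g x ≤ g (update x i (c • x i)) := by
    intro x i c hx hc
    rw [← le_inv_smul_iff_of_pos hc]
    refine (hg x hx).2 fun a ha => ?_
    rw [le_inv_smul_iff_of_pos hc]
    exact (hg _ (hpos hx (smul_nonneg hc.le (hx i)))).1 (ha.smul i hc.le)
  obtain ⟨G, hG⟩ := exists_multilinear_extension g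
    (fun x i u v hx hu hv => le_antisymm
      ((hg _ (hpos hx (add_nonneg hu hv))).2 fun a ha => by
        simpa using hsub _ a ha (hpos hx (add_nonneg hu hv)) i u v hu hv (by simp))
      (hsup x i u v hx hu hv))
    (fun x i c u hx hc hu => le_antisymm
      (by
        have h := hsm (update x i (c • u)) i c⁻¹ (hpos hx (smul_nonneg hc.le hu)) (inv_pos.2 hc)
        rw [update_self, update_idem, inv_smul_smul₀ hc.ne'] at h
        rwa [inv_smul_le_iff_of_pos hc] at h)
      (by simpa using hsm (update x i u) i c (hpos hx hu) hc))
  refine ⟨G, fun T hT x hx => ?_, fun C hC x hx => ?_⟩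
  · rw [hG x hx]
    exact (hg x hx).1 (.single hT)
  · rw [hG x hx]
    exact (hg x hx).2 fun a ha => PartitionSum.le hC ha hx

end RieszKantorovich
/-! ### The Riesz space of regular homogeneous polynomials -/

section MultilinearOrder

variable {n : ℕ} {E F : Type*} [AddCommGroup E] [Module ℝ E] [Lattice E] [IsOrderedAddMonoid E]
  [AddCommGroup F] [Module ℝ F] [PartialOrder F] [IsOrderedAddMonoid F]

/-- Expanding `W (x + (y - x))` gives nonnegative terms, one of which is `W x`. -/
theorem MultilinearMap.apply_le_of_nonneg {W : MultilinearMap ℝ (fun _ : Fin n => E) F}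
    (hW : ∀ x : Fin n → E, (∀ i, 0 ≤ x i) → 0 ≤ W x) {x y : Fin n → E} (hx : ∀ i, 0 ≤ x i)
    (hxy : ∀ i, x i ≤ y i) : W x ≤ W y := by
  have h : y = x + (y - x) := by abel
  rw [h, W.map_add_univ]
  have h1 := Finset.single_le_sum (s := Finset.univ)
    (f := fun s : Finset (Fin n) => W (s.piecewise x (y - x))) (fun s _ => hW _ fun i => by
      by_cases hi : i ∈ s
      · simpa [hi] using hx i
      · simpa [hi] using hxy i) (Finset.mem_univ Finset.univ)
  simpa using h1

/-- Expand both sides over positive and negative parts. Each term on the left is `±D` at a positive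
tuple, hence at most `W` at that tuple, and these values of `W` add up to the right side. -/
theorem MultilinearMap.apply_le_apply_abs {D W : MultilinearMap ℝ (fun _ : Fin n => E) F}
    (h₁ : ∀ x : Fin n → E, (∀ i, 0 ≤ x i) → D x ≤ W x)
    (h₂ : ∀ x : Fin n → E, (∀ i, 0 ≤ x i) → -D x ≤ W x) (x : Fin n → E) :
    D x ≤ W fun i => |x i| := by
  have hx : x = (fun i => (x i)⁺) + fun i => -(x i)⁻ := by
    funext i
    rw [Pi.add_apply, ← sub_eq_add_neg, posPart_sub_negPart]
  have hx' : (fun i => |x i|) = (fun i => (x i)⁺) + fun i => (x i)⁻ := by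
    funext i
    rw [Pi.add_apply, posPart_add_negPart]
  rw [hx', W.map_add_univ]
  nth_rewrite 1 [hx]
  rw [D.map_add_univ]
  refine Finset.sum_le_sum fun s _ => ?_
  have hs : s.piecewise (fun i => (x i)⁺) (fun i => -(x i)⁻) =
      fun i => (if i ∈ s then (1 : ℝ) else -1) •
        s.piecewise (fun i => (x i)⁺) (fun i => (x i)⁻) i := by
    funext i
    by_cases hi : i ∈ s <;> simp [hi]
  have h0 : ∀ i, 0 ≤ s.piecewise (fun i => (x i)⁺) (fun i => (x i)⁻) i := by
    intro i
    by_cases hi : i ∈ s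
    · simp [hi, posPart_nonneg]
    · simp [hi, negPart_nonneg]
  have hc : (∏ i : Fin n, if i ∈ s then (1 : ℝ) else -1) = 1 ∨
      (∏ i : Fin n, if i ∈ s then (1 : ℝ) else -1) = -1 := by
    refine Finset.prod_induction _ (fun c : ℝ => c = 1 ∨ c = -1) ?_ (Or.inl rfl) ?_
    · rintro a b (rfl | rfl) (rfl | rfl) <;> simp
    · intro i _
      by_cases hi : i ∈ s <;> simp [hi]
  rw [hs, D.map_smul_univ]
  rcases hc with hc | hc <;> rw [hc]
  · rw [one_smul]
    exact h₁ _ h0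
  · rw [neg_one_smul]
    exact h₂ _ h0

end MultilinearOrder

/-! ### Absolute values in Riesz spaces -/

section AbsValue

variable {V : Type*} [AddCommGroup V] [Module ℝ V] [PartialOrder V]

theorem IsRieszSpace.le_absValue (hV : IsRieszSpace V) (x : V) : x ≤ absValue x :=
  (isLUB_absValue (hV.exists_isLUB x (-x))).1 (by simp)

theorem IsRieszSpace.neg_le_absValue (hV : IsRieszSpace V) (x : V) : -x ≤ absValue x :=
  (isLUB_absValue (hV.exists_isLUB x (-x))).1 (by simp)

theorem IsRieszSpace.absValue_le (hV : IsRieszSpace V) {x y : V} (h₁ : x ≤ y) (h₂ : -x ≤ y) :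
    absValue x ≤ y :=
  (isLUB_absValue (hV.exists_isLUB x (-x))).2 (by
    rintro z (rfl | rfl)
    exacts [h₁, h₂])

theorem IsRieszSpace.nonneg_of_le_of_neg_le (hV : IsRieszSpace V) {x y : V} (h₁ : x ≤ y)
    (h₂ : -x ≤ y) : 0 ≤ y := by
  have := hV.isOrderedAddMonoid
  have h : 0 ≤ y + y := by simpa using add_le_add h₁ h₂
  have h' := hV.smul_nonneg (1 / 2 : ℝ) _ (by norm_num) h
  rwa [← two_smul ℝ y, smul_smul, show (1 / 2 : ℝ) * 2 = 1 by norm_num, one_smul] at h'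

theorem IsRieszSpace.absValue_nonneg (hV : IsRieszSpace V) (x : V) : 0 ≤ absValue x :=
  hV.nonneg_of_le_of_neg_le (hV.le_absValue x) (hV.neg_le_absValue x)

theorem IsRieszSpace.absValue_of_nonneg (hV : IsRieszSpace V) {x : V} (hx : 0 ≤ x) :
    absValue x = x := by
  have := hV.isOrderedAddMonoid
  exact le_antisymm (hV.absValue_le le_rfl ((neg_nonpos.2 hx).trans hx)) (hV.le_absValue x)

theorem IsRieszSpace.absValue_add_le (hV : IsRieszSpace V) (x y : V) :
    absValue (x + y) ≤ absValue x + absValue y := by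
  have := hV.isOrderedAddMonoid
  refine hV.absValue_le (add_le_add (hV.le_absValue x) (hV.le_absValue y)) ?_
  rw [neg_add]
  exact add_le_add (hV.neg_le_absValue x) (hV.neg_le_absValue y)

theorem IsRieszSpace.smul_le_smul (hV : IsRieszSpace V) {c : ℝ} (hc : 0 ≤ c) {x y : V}
    (h : x ≤ y) : c • x ≤ c • y := by
  have := hV.isOrderedAddMonoid
  rw [← sub_nonneg, ← smul_sub]
  exact hV.smul_nonneg c _ hc (sub_nonneg.2 h)

theorem IsRieszSpace.absValue_smul_le (hV : IsRieszSpace V) (c : ℝ) (x : V) :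
    absValue (c • x) ≤ |c| • absValue x := by
  have h₁ := hV.smul_le_smul (abs_nonneg c) (hV.le_absValue x)
  have h₂ := hV.smul_le_smul (abs_nonneg c) (hV.neg_le_absValue x)
  rw [smul_neg] at h₂
  rcases le_total 0 c with hc | hc
  · rw [abs_of_nonneg hc] at *
    exact hV.absValue_le h₁ h₂
  · rw [abs_of_nonpos hc] at *
    rw [neg_smul] at h₁ h₂
    rw [neg_neg] at h₂
    exact hV.absValue_le (by simpa using h₂) (by simpa using h₁)

theorem IsRieszSpace.eq_zero_of_absValue (hV : IsRieszSpace V) {x : V} (h : absValue x = 0) :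
    x = 0 := by
  have := hV.isOrderedAddMonoid
  refine le_antisymm (h ▸ hV.le_absValue x) ?_
  have := h ▸ hV.neg_le_absValue x
  exact neg_nonpos.1 this

end AbsValue

/-! ### Suprema of homogeneous polynomials -/

namespace HomPoly

section

variable {n : ℕ} {E F : Type*} [AddCommGroup E] [Module ℝ E] [Lattice E] [IsOrderedAddMonoid E]
  [AddCommGroup F] [Module ℝ F] [PartialOrder F] [IsOrderedAddMonoid F]

theorem le_iff_of_associated {P Q : HomPoly n E F}
    {S T : MultilinearMap ℝ (fun _ : Fin n => E) F} (hS : IsAssociatedTo S P)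
    (hT : IsAssociatedTo T Q) : P ≤ Q ↔ ∀ x : Fin n → E, (∀ i, 0 ≤ x i) → S x ≤ T x := by
  have h : IsAssociatedTo (T - S) (Q - P : HomPoly n E F) :=
    ⟨fun σ x => by simp [hS.symm σ x, hT.symm σ x], fun x => by simp [hS.diag, hT.diag]⟩
  rw [le_iff]
  constructor
  · rintro ⟨R, hR, hR0⟩ x hx
    rw [hR.unique h] at hR0
    simpa using hR0 x hx
  · intro hx
    exact ⟨_, h, fun x h0 => by simpa using hx x h0⟩

instance : IsOrderedAddMonoid (HomPoly n E F) where
  add_le_add_left P Q h R := by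
    rw [le_iff] at h ⊢
    simpa using h

/-- The homogeneous polynomial associated to a symmetric multilinear map. -/
def ofSymm (T : MultilinearMap ℝ (fun _ : Fin n => E) F)
    (hT : ∀ (σ : Equiv.Perm (Fin n)) x, T (fun i => x (σ i)) = T x) : HomPoly n E F :=
  ⟨fun x => T fun _ => x, T, hT, fun _ => rfl⟩

theorem isAssociatedTo_ofSymm (T : MultilinearMap ℝ (fun _ : Fin n => E) F)
    (hT : ∀ (σ : Equiv.Perm (Fin n)) x, T (fun i => x (σ i)) = T x) :
    IsAssociatedTo T (ofSymm T hT) :=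
  ⟨hT, fun _ => rfl⟩

/-- Two multilinear maps that agree on the positive cone are equal. -/
theorem _root_.MultilinearMap.ext_of_nonneg {S T : MultilinearMap ℝ (fun _ : Fin n => E) F}
    (h : ∀ x : Fin n → E, (∀ i, 0 ≤ x i) → S x = T x) : S = T := by
  ext x
  have h₁ := MultilinearMap.apply_le_apply_abs (D := S - T) (W := 0)
    (fun x hx => by simp [h x hx]) (fun x hx => by simp [h x hx]) x
  have h₂ := MultilinearMap.apply_le_apply_abs (D := T - S) (W := 0)
    (fun x hx => by simp [h x hx]) (fun x hx => by simp [h x hx]) x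
  exact le_antisymm (by simpa using h₁) (by simpa using h₂)

end

variable {n : ℕ} {E F : Type*} [AddCommGroup E] [Module ℝ E] [Lattice E] [IsOrderedAddMonoid E]
  [IsOrderedModule ℝ E] [AddCommGroup F] [Module ℝ F] [PartialOrder F] [IsOrderedAddMonoid F]
  [IsOrderedModule ℝ F]

/-- Two homogeneous polynomials with a common upper bound have a supremum if the range is
Dedekind complete. -/
theorem exists_isLUB_pair (hF : IsDedekindComplete F) {P Q B : HomPoly n E F} (hP : P ≤ B)
    (hQ : Q ≤ B) : ∃ R, IsLUB {P, Q} R := by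
  obtain ⟨S, hS⟩ := P.exists_associated
  obtain ⟨T, hT⟩ := Q.exists_associated
  obtain ⟨U, hU⟩ := B.exists_associated
  rw [le_iff_of_associated hS hU] at hP
  rw [le_iff_of_associated hT hU] at hQ
  obtain ⟨G, hG, hG'⟩ := exists_isLUB_multilinear hF (S := {S, T}) ⟨S, by simp⟩ (B := U)
    (by rintro _ (rfl | rfl); exacts [hP, hQ])
  -- Since `S` and `T` are symmetric, permuting the arguments of `G` gives another upper bound, so
  -- leastness applies. Using `σ⁻¹` as well yields equality on the cone.
  have hle : ∀ (σ : Equiv.Perm (Fin n)) (x : Fin n → E), (∀ i, 0 ≤ x i) →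
      G x ≤ G (fun i => x (σ i)) := by
    intro σ x hx
    have := hG' (G.domDomCongr σ) (by
      rintro _ (rfl | rfl) y hy
      · rw [← hS.symm σ y]
        exact hG _ (by simp) _ fun i => hy _
      · rw [← hT.symm σ y]
        exact hG _ (by simp) _ fun i => hy _) x hx
    simpa using this
  have hsymm : ∀ (σ : Equiv.Perm (Fin n)) x, G (fun i => x (σ i)) = G x := by
    intro σ x
    have : G.domDomCongr σ = G := MultilinearMap.ext_of_nonneg fun x hx => by
      refine le_antisymm ?_ (by simpa using hle σ x hx)
      simpa using hle σ⁻¹ (fun i => x (σ i)) fun i => hx _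
    nth_rewrite 2 [← this]
    rfl
  refine ⟨ofSymm G hsymm, ?_, ?_⟩
  · rintro _ (rfl | rfl)
    · exact (le_iff_of_associated hS (isAssociatedTo_ofSymm G hsymm)).2 (hG _ (by simp))
    · exact (le_iff_of_associated hT (isAssociatedTo_ofSymm G hsymm)).2 (hG _ (by simp))
  · intro C hC
    obtain ⟨V, hV⟩ := C.exists_associated
    refine (le_iff_of_associated (isAssociatedTo_ofSymm G hsymm) hV).2 (hG' V ?_)
    rintro _ (rfl | rfl)
    · exact (le_iff_of_associated hS hV).1 (hC (by simp))
    · exact (le_iff_of_associated hT hV).1 (hC (by simp))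

end HomPoly

/-- The regular homogeneous polynomials with values in a Dedekind complete Riesz space form a Riesz
space. -/
theorem isRieszSpace_regHomPoly {n : ℕ} {E F : Type*} [AddCommGroup E] [Module ℝ E] [Lattice E]
    [IsOrderedAddMonoid E] [IsOrderedModule ℝ E] [AddCommGroup F] [Module ℝ F] [PartialOrder F]
    [IsOrderedAddMonoid F] [IsOrderedModule ℝ F] (hF : IsDedekindComplete F) :
    IsRieszSpace (RegHomPoly n E F) where
  isOrderedAddMonoid := inferInstance
  smul_nonneg c P hc hP := HomPoly.nonneg_iff.2
    (HomPoly.isPositive_smul hc (HomPoly.nonneg_iff.1 (show 0 ≤ P.1 from hP)))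
  exists_isLUB := by
    rintro ⟨P, Q, R, hQ, hR, rfl⟩ ⟨P', Q', R', hQ', hR', rfl⟩
    obtain ⟨Z, hZ⟩ := HomPoly.exists_isLUB_pair hF (P := Q - R) (Q := Q' - R') (B := Q + Q')
      ((sub_le_self Q hR).trans (le_add_of_nonneg_right hQ'))
      ((sub_le_self Q' hR').trans (le_add_of_nonneg_left hQ))
    -- The supremum is regular because `Z = (R + Z) - R`, and `Q - R ≤ Z` gives `R + Z ≥ Q ≥ 0`.
    refine ⟨⟨Z, R + Z, R, ?_, hR, by abel⟩, ?_, ?_⟩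
    · have := hZ.1 (show Q - R ∈ _ by simp)
      exact hQ.trans (sub_le_iff_le_add'.1 this)
    · rintro _ (rfl | rfl)
      · exact hZ.1 (show Q - R ∈ _ by simp)
      · exact hZ.1 (show Q' - R' ∈ _ by simp)
    · intro C hC
      refine hZ.2 ?_
      rintro _ (rfl | rfl)
      · exact hC (Set.mem_insert _ _)
      · exact hC (Set.mem_insert_of_mem _ rfl)

theorem IsRieszSpace.absValue_smul {V : Type*} [AddCommGroup V] [Module ℝ V] [PartialOrder V]
    (hV : IsRieszSpace V) (c : ℝ) (x : V) : absValue (c • x) = |c| • absValue x := by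
  refine le_antisymm (hV.absValue_smul_le c x) ?_
  rcases eq_or_ne c 0 with rfl | hc
  · simpa using hV.absValue_nonneg _
  · have h := hV.smul_le_smul (abs_nonneg c) (hV.absValue_smul_le c⁻¹ (c • x))
    rwa [inv_smul_smul₀ hc, smul_smul, abs_inv, mul_inv_cancel₀ (abs_ne_zero.2 hc),
      one_smul] at h

/-- A norm on a real vector space is complete if absolutely convergent series converge. -/
theorem exists_tendsto_of_summable_imp_tendsto {V : Type*} [AddCommGroup V] [Module ℝ V]
    {N : V → ℝ} (nonneg : ∀ x, 0 ≤ N x) (eq_zero_iff : ∀ x, N x = 0 ↔ x = 0)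
    (smul : ∀ (c : ℝ) (x : V), N (c • x) = |c| * N x) (add_le : ∀ x y, N (x + y) ≤ N x + N y)
    (h : ∀ u : ℕ → V, Summable (fun k => N (u k)) →
      ∃ a, Tendsto (fun m => N (∑ k ∈ Finset.range m, u k - a)) atTop (𝓝 0))
    (u : ℕ → V) (hu : ∀ ε : ℝ, 0 < ε → ∃ k, ∀ i ≥ k, ∀ j ≥ k, N (u i - u j) < ε) :
    ∃ x, Tendsto (fun i => N (u i - x)) atTop (𝓝 0) := by
  let _ : Norm V := ⟨N⟩
  have core : NormedSpace.Core ℝ V :=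
    { norm_nonneg := nonneg
      norm_smul := smul
      norm_triangle := add_le
      norm_eq_zero_iff := eq_zero_iff }
  let _ : NormedAddCommGroup V := NormedAddCommGroup.ofCore core
  have : CompleteSpace V :=
    NormedAddCommGroup.completeSpace_of_summable_imp_tendsto fun u hu => by
      obtain ⟨a, ha⟩ := h u hu
      exact ⟨a, tendsto_iff_norm_sub_tendsto_zero.2 ha⟩
  have hc : CauchySeq u := Metric.cauchySeq_iff.2 fun ε hε => by
    obtain ⟨k, hk⟩ := hu ε hε
    refine ⟨k, fun i hi j hj => ?_⟩
    rw [dist_eq_norm]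
    exact hk i hi j hj
  obtain ⟨x, hx⟩ := cauchySeq_tendsto_of_complete hc
  exact ⟨x, tendsto_iff_norm_sub_tendsto_zero.1 hx⟩

theorem ContHomPoly.norm_apply_le {n : ℕ} {E F : Type*} [NormedAddCommGroup E] [NormedSpace ℝ E]
    [NormedAddCommGroup F] [NormedSpace ℝ F] (P : ContHomPoly n E F) (x : E) :
    ‖P.1 x‖ ≤ P.1.supNorm * ‖x‖ ^ n := by
  have hx : x = ‖x‖ • ‖x‖⁻¹ • x := by
    rcases eq_or_ne x 0 with rfl | hx
    · simp
    · rw [smul_inv_smul₀ (norm_ne_zero_iff.2 hx)]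
  nth_rewrite 1 [hx]
  rw [HomPoly.map_smul_pow, norm_smul, norm_pow, norm_norm, mul_comm]
  gcongr
  refine P.le_supNorm ?_
  rw [norm_smul, norm_inv, norm_norm]
  exact inv_mul_le_one_of_le₀ le_rfl (norm_nonneg x)

/-! ### Norm estimates from domination, and dominated series -/

section BanachLattice

variable {n : ℕ} {E F : Type*}
    [NormedAddCommGroup E] [NormedSpace ℝ E] [Lattice E] [IsOrderedAddMonoid E]
    [IsOrderedModule ℝ E] [HasSolidNorm E]
    [NormedAddCommGroup F] [NormedSpace ℝ F] [Lattice F] [IsOrderedAddMonoid F]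
    [IsOrderedModule ℝ F] [HasSolidNorm F]

/-- Domination gives `|P x| ≤ Q |x|`, and `|x|` has the same norm as `x`. Continuity is needed only
for `Q`, to make its supremum finite. -/
theorem HomPoly.supNorm_le_of_le {P Q : HomPoly n E F} (hQ : Q ∈ continuousHomPoly n E F)
    (h₁ : P ≤ Q) (h₂ : -P ≤ Q) : P.supNorm ≤ Q.supNorm := by
  obtain ⟨S, hS⟩ := P.exists_associated
  obtain ⟨S', hS'⟩ := (-P).exists_associated
  obtain ⟨T, hT⟩ := Q.exists_associated
  have hneg : S' = -S := hS'.unique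
    ⟨fun σ x => by simp [hS.symm σ x], fun x => by simp [hS.diag]⟩
  subst hneg
  rw [le_iff_of_associated hS hT] at h₁
  rw [le_iff_of_associated hS' hT] at h₂
  refine csSup_le (ContHomPoly.nonempty _) ?_
  rintro r ⟨x, hx, rfl⟩
  refine le_trans (norm_le_norm_of_abs_le_abs ?_)
    (ContHomPoly.le_supNorm ⟨Q, hQ⟩ (x := |x|) (by rwa [norm_abs_eq_norm]))
  refine le_trans ?_ (le_abs_self _)
  rw [hS.diag, hT.diag]
  exact abs_le'.2 ⟨MultilinearMap.apply_le_apply_abs h₁ h₂ _,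
    MultilinearMap.apply_le_apply_abs (D := -S) h₂ (by simpa using h₁) _⟩

/-- A multilinear map dominated by a continuous homogeneous polynomial is bounded on bounded
sets. -/
theorem MultilinearMap.norm_apply_le_of_dominated {D W : MultilinearMap ℝ (fun _ : Fin n => E) F}
    {w : HomPoly n E F} (hw : w ∈ continuousHomPoly n E F) (hW : IsAssociatedTo W w)
    (h₁ : ∀ x : Fin n → E, (∀ i, 0 ≤ x i) → D x ≤ W x)
    (h₂ : ∀ x : Fin n → E, (∀ i, 0 ≤ x i) → -D x ≤ W x) (x : Fin n → E) :
    ‖D x‖ ≤ w.supNorm * (∑ i, ‖x i‖) ^ n := by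
  have hs : ‖∑ i, |x i|‖ ≤ ∑ i, ‖x i‖ :=
    (norm_sum_le _ _).trans (Finset.sum_le_sum fun i _ => (norm_abs_eq_norm (x i)).le)
  have h0 : ∀ x : Fin n → E, (∀ i, 0 ≤ x i) → 0 ≤ W x := fun x hx =>
    (abs_nonneg _).trans (abs_le'.2 ⟨h₁ x hx, h₂ x hx⟩)
  -- Every `|x i|` is below the sum of all of them, so monotonicity of `W` moves the estimate to the
  -- diagonal, where the sup norm of `w` controls it.
  have hle : |D x| ≤ w (∑ i, |x i|) := by
    rw [hW.diag]
    refine (abs_le'.2 ⟨MultilinearMap.apply_le_apply_abs h₁ h₂ _,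
      MultilinearMap.apply_le_apply_abs (D := -D) h₂ (by simpa using h₁) _⟩).trans ?_
    exact MultilinearMap.apply_le_of_nonneg h0 (fun i => abs_nonneg _) fun i =>
      Finset.single_le_sum (f := fun i => |x i|) (fun i _ => abs_nonneg _) (Finset.mem_univ i)
  calc ‖D x‖ ≤ ‖w (∑ i, |x i|)‖ := norm_le_norm_of_abs_le_abs (hle.trans (le_abs_self _))
    _ ≤ w.supNorm * ‖∑ i, |x i|‖ ^ n := ContHomPoly.norm_apply_le ⟨w, hw⟩ _
    _ ≤ _ := by
      gcongr
      exact HomPoly.supNorm_nonneg _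

/-- A series of multilinear maps dominated by an absolutely convergent series of continuous
homogeneous polynomials converges pointwise to a multilinear map. -/
theorem MultilinearMap.exists_hasSum_of_dominated [CompleteSpace F]
    {D W : ℕ → MultilinearMap ℝ (fun _ : Fin n => E) F}
    {w : ℕ → HomPoly n E F} (hw : ∀ k, w k ∈ continuousHomPoly n E F)
    (hW : ∀ k, IsAssociatedTo (W k) (w k))
    (h₁ : ∀ k, ∀ x : Fin n → E, (∀ i, 0 ≤ x i) → D k x ≤ W k x)
    (h₂ : ∀ k, ∀ x : Fin n → E, (∀ i, 0 ≤ x i) → -D k x ≤ W k x)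
    (hsum : Summable fun k => (w k).supNorm) :
    ∃ T : MultilinearMap ℝ (fun _ : Fin n => E) F, ∀ x, HasSum (fun k => D k x) (T x) := by
  have hs : ∀ x, Summable fun k => D k x := fun x =>
    Summable.of_norm_bounded (hsum.mul_right _) fun k =>
      norm_apply_le_of_dominated (hw k) (hW k) (h₁ k) (h₂ k) x
  refine ⟨MultilinearMap.mk' (fun x => ∑' k, D k x) ?_ ?_, fun x => (hs x).hasSum⟩
  · intro x i u v
    simp only [MultilinearMap.map_update_add]
    exact (hs _).tsum_add (hs _)
  · intro x i c u
    simp only [MultilinearMap.map_update_smul]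
    exact (hs _).tsum_const_smul c

/-- Sums of positive, absolutely convergent series stay in a closed space of polynomials. -/
theorem HomPoly.mem_of_hasSum [CompleteSpace F] {A : Submodule ℝ (HomPoly n E F)}
    (hAcont : A ≤ continuousHomPoly n E F)
    (hAclosed : IsClosed {P : ContHomPoly n E F | (P : HomPoly n E F) ∈ A})
    {w : ℕ → HomPoly n E F} (hw : ∀ k, w k ∈ A) (hsum : Summable fun k => (w k).supNorm)
    {W : HomPoly n E F} (hW : ∀ x, HasSum (fun k => w k x) (W x)) :
    W ∈ A ∧ W.supNorm ≤ ∑' k, (w k).supNorm := by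
  have hcont : W ∈ continuousHomPoly n E F := by
    have h : ∀ r : ℝ, ContinuousOn (fun x => ∑' k, w k x) (Metric.ball 0 r) := fun r =>
      continuousOn_tsum (fun k => (show Continuous (w k) from hAcont (hw k)).continuousOn)
        (hsum.mul_right (r ^ n)) fun k x hx => by
          refine (ContHomPoly.norm_apply_le ⟨w k, hAcont (hw k)⟩ x).trans ?_
          have := supNorm_nonneg (w k)
          have hx' : ‖x‖ ≤ r := (mem_ball_zero_iff.1 hx).le
          gcongr
    have hW' : (fun x => ∑' k, w k x) = W := funext fun x => (hW x).tsum_eq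
    change Continuous W
    rw [← hW']
    exact continuous_iff_continuousAt.2 fun x => (h (‖x‖ + 1)).continuousAt
      (Metric.isOpen_ball.mem_nhds (by simp))
  -- This tail bound gives both sup-norm convergence of the partial sums and, at `m = 0`, the norm
  -- estimate.
  have hbound : ∀ m, (W - ∑ k ∈ Finset.range m, w k).supNorm ≤
      ∑' k, (w (k + m)).supNorm := by
    intro m
    refine csSup_le (ContHomPoly.nonempty _) ?_
    rintro r ⟨x, hx, rfl⟩
    have h1 : (W - ∑ k ∈ Finset.range m, w k) x = W x - ∑ k ∈ Finset.range m, w k x := by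
      rw [sub_apply]
      congr 1
      induction m with
      | zero => simp
      | succ m ih => rw [Finset.sum_range_succ, Finset.sum_range_succ, add_apply, ih]
    rw [h1]
    refine HasSum.norm_le_of_bounded ((hasSum_nat_add_iff' m).2 (hW x))
      ((summable_nat_add_iff m).2 hsum).hasSum fun k => ?_
    exact ContHomPoly.le_supNorm ⟨w (k + m), hAcont (hw _)⟩ hx
  refine ⟨?_, by simpa using hbound 0⟩
  have hmem : ∀ m, ∑ k ∈ Finset.range m, w k ∈ A := fun m => A.sum_mem fun k _ => hw k
  have htend : Tendsto (fun m => (⟨_, hAcont (hmem m)⟩ : ContHomPoly n E F)) atTop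
      (𝓝 ⟨W, hcont⟩) := by
    rw [tendsto_iff_norm_sub_tendsto_zero]
    refine squeeze_zero (fun _ => norm_nonneg _) (fun m => ?_)
      (tendsto_sum_nat_add fun k => (w k).supNorm)
    rw [norm_sub_rev]
    exact hbound m
  exact hAclosed.mem_of_tendsto htend (Eventually.of_forall hmem)

/-- Termwise dominated series of homogeneous polynomials. -/
theorem HomPoly.exists_hasSum_of_dominated [CompleteSpace F] {A : Submodule ℝ (HomPoly n E F)}
    (hAcont : A ≤ continuousHomPoly n E F)
    (hAclosed : IsClosed {P : ContHomPoly n E F | (P : HomPoly n E F) ∈ A})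
    {d w : ℕ → HomPoly n E F} (hw : ∀ k, w k ∈ A) (hsum : Summable fun k => (w k).supNorm)
    (h₁ : ∀ k, d k ≤ w k) (h₂ : ∀ k, -d k ≤ w k) :
    ∃ D W : HomPoly n E F, W ∈ A ∧ D ≤ W ∧ -D ≤ W ∧ W.supNorm ≤ ∑' k, (w k).supNorm ∧
      ∀ x, HasSum (fun k => d k x) (D x) := by
  choose S hS using fun k => (d k).exists_associated
  choose T hT using fun k => (w k).exists_associated
  have hS' : ∀ k, IsAssociatedTo (-S k) (-d k : HomPoly n E F) := fun k =>
    ⟨fun σ x => by simp [(hS k).symm σ x], fun x => by simp [(hS k).diag]⟩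
  have h₁' := fun k => (le_iff_of_associated (hS k) (hT k)).1 (h₁ k)
  have h₂' := fun k => (le_iff_of_associated (hS' k) (hT k)).1 (h₂ k)
  have h0 : ∀ k, ∀ x : Fin n → E, (∀ i, 0 ≤ x i) → 0 ≤ T k x := fun k x hx =>
    (abs_nonneg _).trans (abs_le'.2 ⟨h₁' k x hx, h₂' k x hx⟩)
  have hwc := fun k => hAcont (hw k)
  obtain ⟨D, hD⟩ := MultilinearMap.exists_hasSum_of_dominated hwc hT h₁' h₂' hsum
  -- The dominating series itself is summed by the same lemma, each term dominating itself.
  obtain ⟨W, hW⟩ := MultilinearMap.exists_hasSum_of_dominated hwc hT (fun k x _ => le_rfl)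
    (fun k x hx => (neg_nonpos.2 (h0 k x hx)).trans (h0 k x hx)) hsum
  have hDs : ∀ (σ : Equiv.Perm (Fin n)) x, D (fun i => x (σ i)) = D x := fun σ x =>
    (hD _).unique (by simpa [(hS _).symm σ x] using hD x)
  have hWs : ∀ (σ : Equiv.Perm (Fin n)) x, W (fun i => x (σ i)) = W x := fun σ x =>
    (hW _).unique (by simpa [(hT _).symm σ x] using hW x)
  have hDa := isAssociatedTo_ofSymm D hDs
  have hWa := isAssociatedTo_ofSymm W hWs
  have hDa' : IsAssociatedTo (-D) (-ofSymm D hDs : HomPoly n E F) :=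
    ⟨fun σ x => by simp [hDs σ x], fun x => by simp [hDa.diag]⟩
  obtain ⟨hWA, hWn⟩ := mem_of_hasSum hAcont hAclosed hw hsum (W := ofSymm W hWs)
    fun x => by simpa [(hT _).diag, hWa.diag] using hW fun _ => x
  refine ⟨ofSymm D hDs, ofSymm W hWs, hWA, ?_, ?_, hWn, fun x => ?_⟩
  · exact (le_iff_of_associated hDa hWa).2 fun x hx =>
      hasSum_le (fun k => h₁' k x hx) (hD x) (hW x)
  · exact (le_iff_of_associated hDa' hWa).2 fun x hx =>
      hasSum_le (fun k => h₂' k x hx) (hD x).neg (hW x)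
  · simpa [(hS _).diag, hDa.diag] using hD fun _ => x

/-! ### Order structure of the regular part -/

variable {A : Submodule ℝ (HomPoly n E F)}

theorem exists_positiveElements_bound {P : RegHomPoly n E F} (hP : P ∈ regularPart A) :
    ∃ C ∈ positiveElements A, P ≤ C ∧ -P ≤ C := by
  induction hP using Submodule.span_induction with
  | mem Q hQ => exact ⟨Q, hQ, le_rfl, (neg_nonpos.2 hQ.2).trans hQ.2⟩
  | zero => exact ⟨0, ⟨A.zero_mem, le_rfl⟩, le_rfl, by simp⟩
  | add P Q _ _ hP hQ =>
    obtain ⟨C, hC, h₁, h₂⟩ := hP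
    obtain ⟨C', hC', h₁', h₂'⟩ := hQ
    refine ⟨C + C', ⟨A.add_mem hC.1 hC'.1, add_nonneg hC.2 hC'.2⟩, add_le_add h₁ h₁', ?_⟩
    rw [neg_add]
    exact add_le_add h₂ h₂'
  | smul c P _ hP =>
    obtain ⟨C, hC, h₁, h₂⟩ := hP
    have hmono : ∀ {a : ℝ} {P Q : RegHomPoly n E F}, 0 ≤ a → P ≤ Q → a • P ≤ a • Q := by
      intro a P Q ha h
      rw [← sub_nonneg, ← smul_sub]
      exact HomPoly.nonneg_iff.2 (HomPoly.isPositive_smul ha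
        (HomPoly.nonneg_iff.1 (show 0 ≤ (Q - P).1 from sub_nonneg.2 h)))
    refine ⟨|c| • C, ⟨A.smul_mem _ hC.1, ?_⟩, ?_⟩
    · simpa using hmono (abs_nonneg c) hC.2
    · rcases le_total 0 c with hc | hc
      · rw [abs_of_nonneg hc, ← smul_neg]
        exact ⟨hmono hc h₁, hmono hc h₂⟩
      · rw [abs_of_nonpos hc, ← neg_smul]
        refine ⟨?_, hmono (neg_nonneg.2 hc) h₁⟩
        simpa using hmono (neg_nonneg.2 hc) h₂

/-- The one place where domination meets signed polynomials: shifting by `C` gives `0 ≤ P + C ≤ C +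
C`, and then `P = (P + C) - C`. -/
theorem mem_regularPart_of_le (hAdom : HasDominationProperty A) {P C : RegHomPoly n E F}
    (hC : C ∈ positiveElements A) (h₁ : P ≤ C) (h₂ : -P ≤ C) : P ∈ regularPart A := by
  have h0 : 0 ≤ P + C := by simpa using neg_le_iff_add_nonneg'.1 h₂
  have hmem : P + C ∈ positiveElements A :=
    ⟨hAdom _ (C + C).1 h0 (add_le_add_left h₁ C) (A.add_mem hC.1 hC.1), h0⟩
  have h := (regularPart A).sub_mem (Submodule.subset_span hmem) (Submodule.subset_span hC)
  simpa using h

theorem absValue_mem_positiveElements (hR : IsRieszSpace (RegHomPoly n E F))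
    (hAdom : HasDominationProperty A) {P : RegHomPoly n E F} (hP : P ∈ regularPart A) :
    absValue P ∈ positiveElements A := by
  obtain ⟨C, hC, h₁, h₂⟩ := exists_positiveElements_bound hP
  exact ⟨hAdom _ _ (hR.absValue_nonneg P) (hR.absValue_le h₁ h₂) hC.1, hR.absValue_nonneg P⟩

theorem supNorm_mono_of_positiveElements (hAcont : A ≤ continuousHomPoly n E F)
    {P Q : RegHomPoly n E F} (hP : 0 ≤ P) (h : P ≤ Q) (hQ : Q ∈ positiveElements A) :
    P.1.supNorm ≤ Q.1.supNorm :=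
  HomPoly.supNorm_le_of_le (hAcont hQ.1) h ((neg_nonpos.2 hP).trans hQ.2)

/-- The infimum is attained: `|P|` is itself an admissible competitor, and the sup norm is monotone.
-/
theorem dominatedNorm_eq_regularNorm (hR : IsRieszSpace (RegHomPoly n E F))
    (hAcont : A ≤ continuousHomPoly n E F) (hAdom : HasDominationProperty A)
    {P : RegHomPoly n E F} (hP : P ∈ regularPart A) : dominatedNorm A P = regularNorm P := by
  refine IsLeast.csInf_eq
    ⟨⟨absValue P, absValue_mem_positiveElements hR hAdom hP, le_rfl, rfl⟩, ?_⟩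
  rintro r ⟨Q, hQ, hle, rfl⟩
  exact supNorm_mono_of_positiveElements hAcont (hR.absValue_nonneg P) hle hQ

theorem isRieszIdeal_regularPart (hR : IsRieszSpace (RegHomPoly n E F))
    (hAdom : HasDominationProperty A) : IsRieszIdeal (regularPart A) := fun P _ hQ h =>
  mem_regularPart_of_le hAdom (absValue_mem_positiveElements hR hAdom hQ)
    ((hR.le_absValue P).trans h) ((hR.neg_le_absValue P).trans h)

theorem isRieszSpace_regularPart (hR : IsRieszSpace (RegHomPoly n E F))
    (hAdom : HasDominationProperty A) : IsRieszSpace ↥(regularPart A) where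
  isOrderedAddMonoid := inferInstance
  smul_nonneg c P hc hP := hR.smul_nonneg c P.1 hc hP
  exists_isLUB P Q := by
    obtain ⟨Z, hZ⟩ := hR.exists_isLUB P.1 Q.1
    obtain ⟨C, hC, h₁, h₂⟩ := exists_positiveElements_bound P.2
    obtain ⟨C', hC', h₁', h₂'⟩ := exists_positiveElements_bound Q.2
    have hPZ : P.1 ≤ Z := hZ.1 (Set.mem_insert _ _)
    have hQZ : Q.1 ≤ Z := hZ.1 (Set.mem_insert_of_mem _ rfl)
    have hmem : Z ∈ regularPart A := by
      -- Here `Z ≤ C + C'` because `Z` is the least upper bound, and `-Z ≤ -P ≤ C`.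
      refine mem_regularPart_of_le hAdom (C := C + C')
        ⟨A.add_mem hC.1 hC'.1, add_nonneg hC.2 hC'.2⟩ (hZ.2 ?_) ?_
      · rintro _ (rfl | rfl)
        · exact h₁.trans (le_add_of_nonneg_right hC'.2)
        · exact h₁'.trans (le_add_of_nonneg_left hC.2)
      · exact (neg_le_neg hPZ).trans (h₂.trans (le_add_of_nonneg_right hC'.2))
    refine ⟨⟨Z, hmem⟩, ?_, fun B hB => hZ.2 ?_⟩
    · rintro _ (rfl | rfl)
      exacts [hPZ, hQZ]
    · rintro _ (rfl | rfl)
      · exact hB (Set.mem_insert _ _)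
      · exact hB (Set.mem_insert_of_mem _ rfl)

/-- `IsBanachLattice` uses the absolute value intrinsic to the subspace, whereas the norms use the
ambient one. They coincide because the ambient one lies in the subspace. -/
theorem coe_absValue_regularPart (hR : IsRieszSpace (RegHomPoly n E F))
    (hAdom : HasDominationProperty A) (P : ↥(regularPart A)) :
    (absValue P).1 = absValue P.1 := by
  have hR' := isRieszSpace_regularPart hR hAdom
  have hmem : absValue P.1 ∈ regularPart A :=
    Submodule.subset_span (absValue_mem_positiveElements hR hAdom P.2)
  refine le_antisymm ?_ (hR.absValue_le (hR'.le_absValue P) (hR'.neg_le_absValue P))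
  exact hR'.absValue_le (y := ⟨_, hmem⟩) (hR.le_absValue P.1) (hR.neg_le_absValue P.1)

/-! ### Completeness and the Banach lattice structure -/

/-- Absolutely convergent series converge in the regular norm on `regularPart A`. -/
theorem exists_tendsto_regularNorm [CompleteSpace F] (hR : IsRieszSpace (RegHomPoly n E F))
    (hAcont : A ≤ continuousHomPoly n E F)
    (hAclosed : IsClosed {P : ContHomPoly n E F | (P : HomPoly n E F) ∈ A})
    (hAdom : HasDominationProperty A) (u : ℕ → ↥(regularPart A))
    (hu : Summable fun k => regularNorm (u k).1) :
    ∃ a : ↥(regularPart A),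
      Tendsto (fun m => regularNorm (∑ k ∈ Finset.range m, u k - a).1) atTop (𝓝 0) := by
  have hpos := fun k => absValue_mem_positiveElements hR hAdom (u k).2
  -- All tails are summed at once: `D m` is the sum of `u (k + m)`, dominated by `W m`, whose norm
  -- is at most the tail of the series of norms.
  have key := fun m => HomPoly.exists_hasSum_of_dominated hAcont hAclosed
    (d := fun k => (u (k + m)).1.1) (w := fun k => (absValue (u (k + m)).1).1)
    (fun k => (hpos _).1) ((summable_nat_add_iff m).2 hu)
    (fun k => hR.le_absValue (u (k + m)).1) (fun k => hR.neg_le_absValue (u (k + m)).1)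
  choose D W hWA h₁ h₂ hn hD using key
  have hW0 : ∀ m, 0 ≤ W m := by
    intro m
    have h := add_le_add (h₁ m) (h₂ m)
    rw [add_neg_cancel, HomPoly.nonneg_iff, ← two_smul ℝ] at h
    have h' := HomPoly.isPositive_smul (c := 1 / 2) (by norm_num) h
    rw [smul_smul] at h'
    rw [HomPoly.nonneg_iff]
    norm_num at h'
    exact h'
  let W' : ℕ → RegHomPoly n E F := fun m => ⟨W m, W m, 0, hW0 m, le_rfl, by simp⟩
  let D' : ℕ → RegHomPoly n E F := fun m => ⟨D m, D m + W m, W m,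
    by simpa using neg_le_iff_add_nonneg'.1 (h₂ m), hW0 m, by abel⟩
  have hW' : ∀ m, W' m ∈ positiveElements A := fun m => ⟨hWA m, hW0 m⟩
  refine ⟨⟨D' 0, mem_regularPart_of_le hAdom (hW' 0) (h₁ 0) (h₂ 0)⟩, ?_⟩
  refine squeeze_zero (fun _ => HomPoly.supNorm_nonneg _) (fun m => ?_)
    (tendsto_sum_nat_add fun k => regularNorm (u k).1)
  have hcoe : ∀ m x, (∑ k ∈ Finset.range m, u k).1.1 x =
      ∑ k ∈ Finset.range m, (u k).1.1 x := by
    intro m x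
    induction m with
    | zero => rfl
    | succ m ih =>
      rw [Finset.sum_range_succ, Finset.sum_range_succ, ← ih]
      rfl
  -- The error of the partial sum is minus the tail, so `|D m| ≤ W m` bounds its regular norm.
  have heq : (∑ k ∈ Finset.range m, u k).1 - D' 0 = -D' m := by
    refine Subtype.ext (HomPoly.ext fun x => ?_)
    have h := (hD m x).unique ((hasSum_nat_add_iff' m).2 (hD 0 x))
    change (∑ k ∈ Finset.range m, u k).1.1 x - D 0 x = -D m x
    rw [h, hcoe]
    simp
  change regularNorm ((∑ k ∈ Finset.range m, u k).1 - D' 0) ≤ _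
  rw [heq]
  refine le_trans ?_ (hn m)
  refine supNorm_mono_of_positiveElements hAcont (hR.absValue_nonneg _) ?_ (hW' m)
  exact hR.absValue_le (h₂ m) (by rw [neg_neg]; exact h₁ m)

theorem isBanachLattice_regularPart [CompleteSpace F] (hR : IsRieszSpace (RegHomPoly n E F))
    (hAcont : A ≤ continuousHomPoly n E F)
    (hAclosed : IsClosed {P : ContHomPoly n E F | (P : HomPoly n E F) ∈ A})
    (hAdom : HasDominationProperty A) :
    IsBanachLattice ↥(regularPart A) (fun P => regularNorm P.1) := by
  have hpos := fun P : ↥(regularPart A) => absValue_mem_positiveElements hR hAdom P.2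
  have hnonneg : ∀ P : ↥(regularPart A), 0 ≤ regularNorm P.1 := fun P =>
    HomPoly.supNorm_nonneg _
  have hzero : ∀ P : ↥(regularPart A), regularNorm P.1 = 0 ↔ P = 0 := by
    intro P
    -- The regular norm is the `ContHomPoly` norm of `|P|`, so definiteness is inherited from there.
    have h1 : regularNorm P.1 = ‖(⟨_, hAcont (hpos P).1⟩ : ContHomPoly n E F)‖ := rfl
    rw [h1, norm_eq_zero]
    constructor
    · intro h
      exact Subtype.ext (hR.eq_zero_of_absValue (Subtype.ext
        (congrArg (fun Q : ContHomPoly n E F => Q.1) h)))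
    · rintro rfl
      exact Subtype.ext (congrArg (fun Q : RegHomPoly n E F => Q.1)
        (hR.absValue_of_nonneg (x := 0) le_rfl))
  have hsmul : ∀ (c : ℝ) (P : ↥(regularPart A)),
      regularNorm (c • P).1 = |c| * regularNorm P.1 := by
    intro c P
    have h := norm_smul |c| (⟨_, hAcont (hpos P).1⟩ : ContHomPoly n E F)
    rw [Real.norm_eq_abs, abs_abs] at h
    refine Eq.trans ?_ h
    change (absValue (c • P.1)).1.supNorm = _
    rw [hR.absValue_smul]
    rfl
  have hadd : ∀ P Q : ↥(regularPart A),
      regularNorm (P + Q).1 ≤ regularNorm P.1 + regularNorm Q.1 := by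
    intro P Q
    refine le_trans (supNorm_mono_of_positiveElements hAcont (hR.absValue_nonneg _)
      (hR.absValue_add_le P.1 Q.1)
      ⟨A.add_mem (hpos P).1 (hpos Q).1, add_nonneg (hpos P).2 (hpos Q).2⟩) ?_
    exact norm_add_le (⟨_, hAcont (hpos P).1⟩ : ContHomPoly n E F) ⟨_, hAcont (hpos Q).1⟩
  exact
    { isRieszSpace_regularPart hR hAdom with
      nonneg := hnonneg
      eq_zero_iff := hzero
      smul := hsmul
      add_le := hadd
      solid := fun P Q h => supNorm_mono_of_positiveElements hAcont (hR.absValue_nonneg _)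
        (by
          rw [← coe_absValue_regularPart hR hAdom, ← coe_absValue_regularPart hR hAdom]
          exact h) (hpos Q)
      complete := exists_tendsto_of_summable_imp_tendsto hnonneg hzero hsmul hadd
        (exists_tendsto_regularNorm hR hAcont hAclosed hAdom) }

end BanachLattice

end

theorem corollary2p2 (n : ℕ) {E F : Type*}
    [NormedAddCommGroup E] [NormedSpace ℝ E] [Lattice E] [IsOrderedAddMonoid E]
    [IsOrderedModule ℝ E] [HasSolidNorm E] [CompleteSpace E]
    [NormedAddCommGroup F] [NormedSpace ℝ F] [Lattice F] [IsOrderedAddMonoid F]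
    [IsOrderedModule ℝ F] [HasSolidNorm F] [CompleteSpace F]
    (hF : IsDedekindComplete F)
    (A : Submodule ℝ (HomPoly n E F)) (hAcont : A ≤ continuousHomPoly n E F)
    (hAclosed : IsClosed {P : ContHomPoly n E F | (P : HomPoly n E F) ∈ A})
    (hAdom : HasDominationProperty A) :
    IsRieszSpace (RegHomPoly n E F) ∧
      IsBanachLattice ↥(regularPart A) (fun P => dominatedNorm A P.1) ∧
      (∀ P ∈ regularPart A, dominatedNorm A P = regularNorm P) ∧
      IsRieszIdeal (regularPart A) := by
  have hR : IsRieszSpace (RegHomPoly n E F) := isRieszSpace_regHomPoly hF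
  have hN : ∀ P ∈ regularPart A, dominatedNorm A P = regularNorm P := fun P hP =>
    dominatedNorm_eq_regularNorm hR hAcont hAdom hP
  refine ⟨hR, ?_, hN, isRieszIdeal_regularPart hR hAdom⟩
  have h := isBanachLattice_regularPart hR hAcont hAclosed hAdom
  rwa [show (fun P : ↥(regularPart A) => regularNorm P.1) = fun P => dominatedNorm A P.1 from
    funext fun P => (hN P.1 P.2).symm] at h
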